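/- For a finite group $G$, the enhanced power graph $\mathcal G_E(G)$ has vertex set $G$, two distinct elements $u,v$ being adjacent if and only if $u,v\in\langle w\rangle$ for some $w\in G$. The proper enhanced power graph $\mathcal G_E^{**}(G)$ is obtained from it by deleting all dominating vertices, i.e. all vertices adjacent to every other vertex. The domination number $\gamma(\Gamma)$ of a graph $\Gamma$ is the least cardinality of a set $D$ of vertices such that every vertex outside $D$ is adjacent to some vertex of $D$. For $k\ge 3$ let $Q_{2^k}=\langle x,y\mid x^{2^{k-1}}=1,\ y^2=x^{2^{k-2}},\ yxy^{-1}=x^{-1}\rangle$ be the generalized quaternion group of order $2^k$. Theorem. Let $G$ be a finite nilpotent group having a generalized quaternion Sylow subgroup, isomorphic to $Q_{2^k}$, $k\ge 3$. Then $G$ is, up to isomorphism, of one of the forms listed below, and $$\gamma(\mathcal G_E^{**}(G))=\begin{cases}2^{k-2}+1, & \text{if } G\cong Q_{2^k},\ \text{or } G\cong\mathbb Z_n\times Q_{2^k} \text{ with } \gcd(n,2)=1,\\[2pt] \min\{r_1,\,2^{k-2}+1\}, & \text{if } G\cong G_1\times Q_{2^k} \text{ with } \gcd(|G_1|,2)=1,\\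 & \text{or } G\cong G_1\times\mathbb Z_n\times Q_{2^k} \text{ with } \gcd(|G_1|,n)=\gcd(|G_1|,2)=\gcd(n,2)=1.\end{cases}$$ Here $n\ge 1$, $G_1$ denotes a nontrivial finite nilpotent group such that for no prime $p$ dividing $|G_1|$ the Sylow $p$-subgroup of $G_1$ is cyclic or generalized quaternion, and $r_1$ is the minimum, over the primes $p$ dividing $|G_1|$, of the number of subgroups of order $p$ in the Sylow $p$-subgroup of $G_1$. -/

import Mathlib

/-- The enhanced power graph of a group: distinct `u`, `v` are adjacent iff both lie in one
cyclic subgroup `⟨w⟩`. -/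
def enhancedPowerGraph (G : Type*) [Group G] : SimpleGraph G where
  Adj u v := u ≠ v ∧ ∃ w : G, u ∈ Subgroup.zpowers w ∧ v ∈ Subgroup.zpowers w
  symm := ⟨fun _ _ h => ⟨h.1.symm, h.2.imp fun _ hw => ⟨hw.2, hw.1⟩⟩⟩
  loopless := ⟨fun _ h => h.1 rfl⟩

/-- The vertices that are adjacent to every other vertex. -/
def dominatingVertices {V : Type*} (Γ : SimpleGraph V) : Set V :=
  {v | ∀ u, u ≠ v → Γ.Adj v u}

/-- The enhanced power graph with all its dominating vertices deleted. -/
def properEnhancedPowerGraph (G : Type*) [Group G] :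
    SimpleGraph ((dominatingVertices (enhancedPowerGraph G))ᶜ : Set G) :=
  (enhancedPowerGraph G).induce (dominatingVertices (enhancedPowerGraph G))ᶜ

/-- `D` is a dominating set: every vertex outside `D` is adjacent to some vertex of `D`. -/
def IsDominatingSet {V : Type*} (Γ : SimpleGraph V) (D : Set V) : Prop :=
  ∀ v, v ∉ D → ∃ u ∈ D, Γ.Adj v u

/-- The least cardinality of a dominating set. -/
noncomputable def dominationNumber {V : Type*} (Γ : SimpleGraph V) : ℕ∞ :=
  ⨅ (D : Set V) (_ : IsDominatingSet Γ D), D.encard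

/-- The generalized quaternion group of order `2 ^ k` (meaningful for `3 ≤ k`); Mathlib's
`QuaternionGroup m` has order `4 * m`. -/
abbrev GenQuaternion (k : ℕ) : Type := QuaternionGroup (2 ^ (k - 2))

/-- `H` is isomorphic to a generalized quaternion group of order `2 ^ k` with `k ≥ 3`. -/
def IsGenQuaternion (H : Type*) [Group H] : Prop :=
  ∃ k : ℕ, 3 ≤ k ∧ Nonempty (H ≃* GenQuaternion k)

/-- Nontrivial finite nilpotent groups none of whose (nontrivial) Sylow subgroups is cyclic or
generalized quaternion. -/
structure IsNilpotentWithoutCyclicOrQuaternionSylow (H : Type*) [Group H] : Prop where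
  finite : Finite H
  nontrivial : Nontrivial H
  nilpotent : Group.IsNilpotent H
  sylow : ∀ p : ℕ, p.Prime → p ∣ Nat.card H → ∀ P : Sylow p H,
    ¬ IsCyclic P ∧ ¬ IsGenQuaternion P

/-- The minimum, over the primes `p` dividing the order of `H`, of the number of subgroups of
order `p` in a Sylow `p`-subgroup of `H`. -/
noncomputable def minNumPrimeOrderSubgroups (H : Type*) [Group H] : ℕ :=
  sInf {r : ℕ | ∃ p : ℕ, p.Prime ∧ p ∣ Nat.card H ∧ ∃ P : Sylow p H,
    r = Nat.card {K : Subgroup P // Nat.card K = p}}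

/-! A finite nilpotent group is the product of its Sylow subgroups, so G splits as A × B × Q with
pairwise coprime orders: Q quaternion, B cyclic of odd order, A odd with no cyclic Sylow subgroup.
Lying in a common cyclic subgroup is then tested componentwise (`CyclicallyRelated.prod_iff`), and B
imposes no condition.

Put m = 2^(k-2). The group Q has m + 1 maximal cyclic subgroups, and an element in two of them is 1
or the central involution, hence related to all of Q. Their generators, placed in the third
coordinate, dominate. If A has several subgroups of order p, their generators dominate too: an
element of A either has a power generating one of them or has order prime to p and commutes with all
of them.

Conversely, let D have fewer than min(r, m + 1) elements. A cyclic group has at most one subgroup of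
order p, so for each p some subgroup of order p in A is missed by every d in D; let v generate the
product of these. Some maximal cyclic generator g of Q is unrelated to every third coordinate that
is not dominating in Q. A neighbour d of (v, 1, g) in D must have trivial first coordinate and
dominating third coordinate, so d is a deleted vertex: a contradiction.

The value r is an upper bound only because an odd p-group with a single subgroup of order p is
cyclic. -/

/-! ### Elements in a common cyclic subgroup -/

/-- Two elements are cyclically related if some cyclic subgroup contains both. -/
def CyclicallyRelated {G : Type*} [Group G] (u v : G) : Prop :=
  ∃ w : G, u ∈ Subgroup.zpowers w ∧ v ∈ Subgroup.zpowers w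

namespace CyclicallyRelated

variable {G H : Type*} [Group G] [Group H]

theorem refl (u : G) : CyclicallyRelated u u :=
  ⟨u, Subgroup.mem_zpowers u, Subgroup.mem_zpowers u⟩

theorem symm {u v : G} (h : CyclicallyRelated u v) : CyclicallyRelated v u :=
  h.imp fun _ hw => ⟨hw.2, hw.1⟩

theorem map (f : G →* H) {u v : G} (h : CyclicallyRelated u v) :
    CyclicallyRelated (f u) (f v) := by
  obtain ⟨w, ⟨i, rfl⟩, ⟨j, rfl⟩⟩ := h
  exact ⟨f w, ⟨i, by simp⟩, ⟨j, by simp⟩⟩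

theorem map_iff (e : G ≃* H) {u v : G} :
    CyclicallyRelated (e u) (e v) ↔ CyclicallyRelated u v :=
  ⟨fun h => by simpa using h.map e.symm.toMonoidHom, fun h => h.map e.toMonoidHom⟩

theorem of_mem_zpowers {u v : G} (h : u ∈ Subgroup.zpowers v) : CyclicallyRelated u v :=
  ⟨v, h, Subgroup.mem_zpowers v⟩

theorem one_left (u : G) : CyclicallyRelated 1 u :=
  of_mem_zpowers (one_mem _)

theorem of_isCyclic [IsCyclic G] (u v : G) : CyclicallyRelated u v :=
  let ⟨w, hw⟩ := IsCyclic.exists_generator (α := G)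
  ⟨w, hw u, hw v⟩

end CyclicallyRelated

/-- If commuting elements have coprime orders, each is a power of their product. -/
theorem Commute.mem_zpowers_mul_of_coprime {G : Type*} [Group G] {x y : G} (h : Commute x y)
    (hco : (orderOf x).Coprime (orderOf y)) : x ∈ Subgroup.zpowers (x * y) := by
  have hx : x ^ orderOf y ∈ Subgroup.zpowers (x * y) :=
    ⟨orderOf y, by simp [h.mul_pow, pow_orderOf_eq_one]⟩
  have h2 : Subgroup.zpowers (x ^ orderOf y) = Subgroup.zpowers x := by
    refine le_antisymm ?_ ?_
    · rw [Subgroup.zpowers_le]; exact Subgroup.npow_mem_zpowers _ _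
    · obtain ⟨m, hm⟩ := exists_pow_eq_self_of_coprime hco.symm
      rw [Subgroup.zpowers_le]
      exact ⟨m, by simpa using hm⟩
  rw [← Subgroup.zpowers_le, h2, Subgroup.zpowers_le] at hx
  exact hx

theorem CyclicallyRelated.of_commute_of_coprime {G : Type*} [Group G] {x y : G} (h : Commute x y)
    (hco : (orderOf x).Coprime (orderOf y)) : CyclicallyRelated x y :=
  ⟨x * y, h.mem_zpowers_mul_of_coprime hco,
    h.eq ▸ h.symm.mem_zpowers_mul_of_coprime hco.symm⟩

/-- In a product of groups of coprime orders, being cyclically related is componentwise. -/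
theorem CyclicallyRelated.prod_iff {H K : Type*} [Group H] [Group K] [Finite H] [Finite K]
    (hco : (Nat.card H).Coprime (Nat.card K)) {u v : H × K} :
    CyclicallyRelated u v ↔ CyclicallyRelated u.1 v.1 ∧ CyclicallyRelated u.2 v.2 := by
  refine ⟨fun h => ⟨h.map (MonoidHom.fst H K), h.map (MonoidHom.snd H K)⟩, ?_⟩
  rintro ⟨⟨w, hu, hv⟩, ⟨z, hu', hv'⟩⟩
  have hcomm : Commute ((w, 1) : H × K) (1, z) := by ext <;> simp
  have hcop : (orderOf ((w, 1) : H × K)).Coprime (orderOf ((1, z) : H × K)) := by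
    simp only [Prod.orderOf_mk, orderOf_one, Nat.lcm_one_right, Nat.lcm_one_left]
    exact hco.of_dvd (orderOf_dvd_natCard w) (orderOf_dvd_natCard z)
  have h1 := hcomm.mem_zpowers_mul_of_coprime hcop
  have h2 := hcomm.symm.mem_zpowers_mul_of_coprime hcop.symm
  rw [← hcomm.eq] at h2
  have key : ∀ t : H × K, t.1 ∈ Subgroup.zpowers w → t.2 ∈ Subgroup.zpowers z →
      t ∈ Subgroup.zpowers (((w, 1) : H × K) * (1, z)) := by
    rintro ⟨t, s⟩ ⟨i, rfl⟩ ⟨j, rfl⟩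
    have := mul_mem (zpow_mem h1 i) (zpow_mem h2 j)
    simpa using this
  exact ⟨_, key u hu hu', key v hv hv'⟩

/-- A finite cyclic group has at most one subgroup of each order. -/
theorem Subgroup.eq_of_natCard_eq_of_le_zpowers {G : Type*} [Group G] [Finite G] {w : G}
    {H K : Subgroup G} (hH : H ≤ zpowers w) (hK : K ≤ zpowers w)
    (h : Nat.card H = Nat.card K) : H = K := by
  have := Fintype.ofFinite G
  classical
  -- A cyclic group has at most n solutions of x ^ n = 1, so L, which supplies `Nat.card L` of them,
  -- is the whole solution set.
  have key : ∀ L : Subgroup G, L ≤ zpowers w → ∀ x : G, x ∈ L ↔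
      x ∈ zpowers w ∧ x ^ Nat.card L = 1 := by
    intro L hL
    let S : Finset (zpowers w) := Finset.univ.filter fun x => x ^ Nat.card L = 1
    let T : Finset (zpowers w) := Finset.univ.filter fun x => (x : G) ∈ L
    have hTS : T ⊆ S := by
      intro x hx
      simp only [T, S, Finset.mem_filter, Finset.mem_univ, true_and] at hx ⊢
      exact Subtype.ext (congrArg (Subtype.val : L → G) (pow_card_eq_one' (x := (⟨x, hx⟩ : L))))
    have hcard : S.card ≤ T.card := by
      calc S.card ≤ Nat.card L := IsCyclic.card_pow_eq_one_le Nat.card_pos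
        _ = T.card := by
          rw [← Nat.card_congr (subgroupOfEquivOfLe hL).toEquiv, Nat.card_eq_fintype_card,
            Fintype.card_subtype]
          simp only [T, mem_subgroupOf]
    have hST := Finset.eq_of_subset_of_card_le hTS hcard
    intro x
    refine ⟨fun hx => ⟨hL hx, ?_⟩, fun ⟨hx, hx'⟩ => ?_⟩
    · exact congrArg Subtype.val (pow_card_eq_one' (x := (⟨x, hx⟩ : L)))
    · have : (⟨x, hx⟩ : zpowers w) ∈ T := by
        rw [hST, Finset.mem_filter]
        exact ⟨Finset.mem_univ _, Subtype.ext hx'⟩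
      simpa [T] using this
  ext x
  rw [key H hH, key K hK, h]

/-! ### Odd p-groups with one subgroup of order p -/

/-- Powers of `b` move past `a` at the cost of the central element `c`. -/
theorem pow_mul_eq_of_mul_eq {G : Type*} [Group G] {a b c : G} (hc : ∀ g, Commute c g)
    (h : b * a = c * (a * b)) (n : ℕ) : b ^ n * a = c ^ n * (a * b ^ n) := by
  induction n with
  | zero => simp
  | succ n ih =>
    have h1 : b * c ^ n = c ^ n * b := ((hc b).pow_left n).eq.symm
    calc b ^ (n + 1) * a = b * (b ^ n * a) := by rw [pow_succ']; group
      _ = (b * c ^ n) * (a * b ^ n) := by rw [ih]; group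
      _ = c ^ n * (b * a) * b ^ n := by rw [h1]; group
      _ = c ^ (n + 1) * (a * b ^ (n + 1)) := by rw [h]; group

/-- Moving b ^ j past the next a costs c ^ j; the exponents 0, ..., n - 1 add up to `n.choose 2`. -/
theorem mul_pow_eq_of_mul_eq {G : Type*} [Group G] {a b c : G} (hc : ∀ g, Commute c g)
    (h : b * a = c * (a * b)) (n : ℕ) :
    (a * b) ^ n = c ^ (n.choose 2) * (a ^ n * b ^ n) := by
  induction n with
  | zero => simp
  | succ n ih =>
    have h2 : a ^ n * c ^ n = c ^ n * a ^ n := ((hc (a ^ n)).pow_left n).eq.symm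
    calc (a * b) ^ (n + 1) = c ^ (n.choose 2) * (a ^ n * (b ^ n * a) * b) := by
          rw [pow_succ, ih]; group
      _ = c ^ (n.choose 2) * ((a ^ n * c ^ n) * (a * b ^ n) * b) := by
          rw [pow_mul_eq_of_mul_eq hc h]; group
      _ = (c ^ (n.choose 2) * c ^ n) * ((a ^ n * a) * (b ^ n * b)) := by rw [h2]; group
      _ = _ := by
          rw [← pow_add, ← pow_succ, ← pow_succ, Nat.choose_succ_succ' n 1, Nat.choose_one_right,
            add_comm]

/-- Normality comes from the normalizer condition. The preimage of a subgroup of order p in P ⧸ M is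
strictly larger than M, so by maximality it is P. -/
theorem IsPGroup.index_eq_of_isCoatom {p : ℕ} [Fact p.Prime] {P : Type*} [Group P] [Finite P]
    (hP : IsPGroup p P) {M : Subgroup P} (hM : IsCoatom M) : M.Normal ∧ M.index = p := by
  have : Group.IsNilpotent P := hP.isNilpotent
  have hn : M.Normal := Subgroup.NormalizerCondition.normal_of_coatom M Group.normalizerCondition_of_isNilpotent hM
  refine ⟨hn, ?_⟩
  obtain ⟨K, hK, hcard⟩ : ∃ K : Subgroup P, M ≤ K ∧ M.relIndex K = p := by
    have hq : IsPGroup p (P ⧸ M) := hP.to_quotient M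
    have hnt : Nontrivial (P ⧸ M) := QuotientGroup.nontrivial_iff.2 hM.1
    have hd : p ∣ Nat.card (P ⧸ M) := by
      obtain ⟨n, hn0, hn⟩ := hq.nontrivial_iff_card.1 hnt
      exact hn ▸ dvd_pow_self p hn0.ne'
    obtain ⟨x, hx⟩ := exists_prime_orderOf_dvd_card' p hd
    refine ⟨(Subgroup.zpowers x).comap (QuotientGroup.mk' M), ?_, ?_⟩
    · intro m hm
      rw [Subgroup.mem_comap, QuotientGroup.mk'_apply, (QuotientGroup.eq_one_iff m).2 hm]
      exact one_mem _
    · have := Subgroup.relIndex_comap ⊥ (QuotientGroup.mk' M)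
        ((Subgroup.zpowers x).comap (QuotientGroup.mk' M))
      rw [Subgroup.map_comap_eq_self_of_surjective (QuotientGroup.mk'_surjective M),
        Subgroup.relIndex_bot_left, Nat.card_zpowers, hx, MonoidHom.comap_bot,
        QuotientGroup.ker_mk'] at this
      exact this
  have hne : M ≠ K := by
    rintro rfl
    rw [Subgroup.relIndex_self] at hcard
    exact (Fact.out : p.Prime).one_lt.ne hcard
  rw [hM.2 K (lt_of_le_of_ne hK hne), Subgroup.relIndex_top_right] at hcard
  exact hcard

theorem Subgroup.commutator_mem_of_index_prime {p : ℕ} [Fact p.Prime] {G : Type*} [Group G]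
    {M : Subgroup G} [M.Normal] (hM : M.index = p) (a b : G) : b * a * (a * b)⁻¹ ∈ M := by
  have : IsCyclic (G ⧸ M) := isCyclic_of_prime_card (p := p) hM
  rw [← QuotientGroup.eq_one_iff]
  let := IsCyclic.commGroup (α := G ⧸ M)
  have h : (b : G ⧸ M) * a = a * b := mul_comm _ _
  simp only [QuotientGroup.mk_mul, QuotientGroup.mk_inv, h, mul_inv_cancel]

/-- For `p` odd, a finite `p`-group with at most one subgroup of order `p` is cyclic. -/
theorem IsPGroup.isCyclic_of_subsingleton_card_eq {p : ℕ} [Fact p.Prime] (hp2 : p ≠ 2)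
    {P : Type*} [Group P] [Finite P] (hP : IsPGroup p P)
    (huniq : ∀ H K : Subgroup P, Nat.card H = p → Nat.card K = p → H = K) : IsCyclic P := by
  have hp : p.Prime := Fact.out
  induction hn : Nat.card P using Nat.strong_induction_on generalizing P with
  | _ n ih =>
  subst hn
  by_contra hnc
  -- Minimal counterexample: proper subgroups inherit uniqueness, hence are cyclic. Two distinct
  -- maximal subgroups M and N then have a central intersection of index p², and the p-th power map
  -- contradicts this index.
  have hprop : ∀ M : Subgroup P, M ≠ ⊤ → IsCyclic M := by
    intro M hM
    refine ih (Nat.card M) ?_ (hP.to_subgroup M) ?_ rfl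
    · refine lt_of_le_of_ne (Subgroup.card_le_card_group M) fun h => hM ?_
      exact Subgroup.eq_top_of_card_eq M h
    · intro H K hH hK
      apply Subgroup.map_injective M.subtype_injective
      apply huniq
      · rw [Subgroup.card_map_of_injective M.subtype_injective, hH]
      · rw [Subgroup.card_map_of_injective M.subtype_injective, hK]
  have hz : ∀ x : P, Subgroup.zpowers x ≠ ⊤ := fun x hx =>
    hnc ⟨x, fun y => (hx ▸ Subgroup.mem_top y : y ∈ Subgroup.zpowers x)⟩
  obtain ⟨M, hM, -⟩ := (eq_top_or_exists_le_coatom (Subgroup.zpowers (1 : P))).resolve_left (hz 1)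
  obtain ⟨y, hy⟩ : ∃ y, y ∉ M := by
    by_contra! h
    exact hM.1 (eq_top_iff.2 fun x _ => h x)
  obtain ⟨N, hN, hyN⟩ := (eq_top_or_exists_le_coatom (Subgroup.zpowers y)).resolve_left (hz y)
  have hyN : y ∈ N := hyN (Subgroup.mem_zpowers y)
  have hMN : M ≠ N := fun h => hy (h ▸ hyN)
  have hsup : M ⊔ N = ⊤ := hM.codisjoint_of_ne hN hMN |>.eq_top
  obtain ⟨hMn, hMi⟩ := hP.index_eq_of_isCoatom hM
  obtain ⟨hNn, hNi⟩ := hP.index_eq_of_isCoatom hN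
  have hMc := hprop M hM.1
  have hNc := hprop N hN.1
  have hcentral : ∀ c ∈ M ⊓ N, ∀ g, Commute c g := by
    intro c hc g
    have hle : M ⊔ N ≤ Subgroup.centralizer {c} := by
      refine sup_le ?_ ?_
      · intro m hm
        rw [Subgroup.mem_centralizer_singleton_iff]
        let := IsCyclic.commGroup (α := M)
        exact congrArg Subtype.val (mul_comm (⟨m, hm⟩ : M) ⟨c, hc.1⟩)
      · intro m hm
        rw [Subgroup.mem_centralizer_singleton_iff]
        let := IsCyclic.commGroup (α := N)
        exact congrArg Subtype.val (mul_comm (⟨m, hm⟩ : N) ⟨c, hc.2⟩)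
    rw [hsup] at hle
    exact (Subgroup.mem_centralizer_singleton_iff.1 (hle (Subgroup.mem_top g))).symm
  have hpow : ∀ x : P, x ^ p ∈ M ⊓ N := fun x =>
    ⟨hMi ▸ M.pow_index_mem x, hNi ▸ N.pow_index_mem x⟩
  have hmul : ∀ a b : P, (a * b) ^ p = a ^ p * b ^ p := by
    intro a b
    obtain ⟨c, hcdef⟩ : ∃ c, c = b * a * (a * b)⁻¹ := ⟨_, rfl⟩
    have hc : ∀ g, Commute c g := hcentral c <| by
      rw [hcdef]
      exact ⟨Subgroup.commutator_mem_of_index_prime hMi a b,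
        Subgroup.commutator_mem_of_index_prime hNi a b⟩
    have hba : b * a = c * (a * b) := by rw [hcdef]; group
    -- b ^ p lies in M ⊓ N and so commutes with a, yet moving it past a costs c ^ p.
    have hcp : c ^ p = 1 := by
      have h1 := pow_mul_eq_of_mul_eq hc hba p
      rw [(hcentral _ (hpow b) a).eq] at h1
      exact right_eq_mul.1 h1
    -- The only use of p odd: 2 < p.
    have hd : p ∣ p.choose 2 := hp.dvd_choose_self two_ne_zero (by have := hp.two_le; omega)
    obtain ⟨t, ht⟩ := hd
    rw [mul_pow_eq_of_mul_eq hc hba, ht, pow_mul, hcp, one_pow, one_mul]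
  let f : P →* P := MonoidHom.mk' (fun x => x ^ p) hmul
  -- Nontrivial kernel elements have order p and all generate the same subgroup, so the kernel is
  -- cyclic of exponent dividing p.
  have hker : Nat.card f.ker ≤ p := by
    have : IsCyclic f.ker := by
      by_cases hbot : f.ker = ⊥
      · rw [hbot]; infer_instance
      · obtain ⟨x, hx, hx1⟩ := (Subgroup.ne_bot_iff_exists_ne_one).1 hbot |>.elim
          fun x hx => (⟨x.1, x.2, fun h => hx (Subtype.ext h)⟩ : ∃ x, x ∈ f.ker ∧ x ≠ 1)
        have hord : ∀ z, z ∈ f.ker → z ≠ 1 → Nat.card (Subgroup.zpowers z) = p := fun z hz hz1 => by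
          rw [Nat.card_zpowers]; exact orderOf_eq_prime hz hz1
        refine ⟨⟨x, hx⟩, fun z => ?_⟩
        by_cases hz1 : z.1 = 1
        · exact ⟨0, Subtype.ext (by simp [hz1])⟩
        · have := huniq _ _ (hord x hx hx1) (hord z.1 z.2 hz1)
          have hz : z.1 ∈ Subgroup.zpowers x := this ▸ Subgroup.mem_zpowers z.1
          obtain ⟨i, hi⟩ := hz
          exact ⟨i, Subtype.ext hi⟩
    obtain ⟨g, hg⟩ := IsCyclic.exists_generator (α := f.ker)
    rw [← orderOf_eq_card_of_forall_mem_zpowers hg]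
    exact orderOf_le_of_pow_eq_one hp.pos (Subtype.ext g.2)
  have hrange : Nat.card f.range ≤ Nat.card (M ⊓ N : Subgroup P) :=
    Subgroup.card_le_of_le (by rintro _ ⟨x, rfl⟩; exact hpow x)
  have hidx : (M ⊓ N).index = p * p := by
    rw [← Subgroup.relIndex_mul_index (inf_le_right : M ⊓ N ≤ N), Subgroup.inf_relIndex_right, hNi,
      ← Subgroup.relIndex_sup_right, sup_comm, hsup, Subgroup.relIndex_top_right, hMi]
  have h1 := Subgroup.card_mul_index (M ⊓ N)
  have h2 := Subgroup.card_mul_index f.ker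
  rw [Subgroup.index_ker] at h2
  have h3 : 0 < Nat.card (M ⊓ N : Subgroup P) := Nat.card_pos
  have h4 : Nat.card f.ker * Nat.card f.range ≤ p * Nat.card (M ⊓ N : Subgroup P) :=
    Nat.mul_le_mul hker hrange
  rw [h2, ← h1, hidx] at h4
  have h5 := hp.two_le
  nlinarith [Nat.mul_pos hp.pos h3]

/-! ### Sylow decomposition of nilpotent groups -/

/-- A finite nilpotent group is the product of its `π`-part and its `π'`-part. -/
theorem Group.IsNilpotent.exists_mulEquiv_prod {G : Type*} [Group G] [Finite G]
    (hG : Group.IsNilpotent G) (π : ℕ → Prop) :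
    ∃ H K : Subgroup G, (∀ q : ℕ, q.Prime → q ∣ Nat.card H → π q) ∧
      (∀ q : ℕ, q.Prime → q ∣ Nat.card K → ¬ π q) ∧ Nonempty (G ≃* H × K) := by
  classical
  obtain ⟨e⟩ := (Group.isNilpotent_of_finite_tfae (G := G).out 0 4 rfl rfl).1 hG
  let Y : (Nat.card G).primeFactors → Type _ := fun p => ∀ P : Sylow p G, (P : Subgroup G)
  let s : (∀ p, Y p) ≃* (∀ p : {p : (Nat.card G).primeFactors // π p.1}, Y p) ×
      (∀ p : {p : (Nat.card G).primeFactors // ¬ π p.1}, Y p) :=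
    { Equiv.piEquivPiSubtypeProd (fun p => π p.1) Y with
      map_mul' := fun _ _ => rfl }
  let E := s.symm.trans e
  have hdiv : ∀ {I : Type} [Finite I] (g : I → (Nat.card G).primeFactors) (q : ℕ), q.Prime →
      q ∣ Nat.card (∀ i, Y (g i)) → ∃ i, (g i).1 = q := by
    intro I _ g q hq h
    have := Fintype.ofFinite I
    rw [Nat.card_pi] at h
    obtain ⟨i, -, hi⟩ := (hq.prime.dvd_finsetProd_iff _).1 h
    refine ⟨i, ?_⟩
    have hprime := Nat.prime_of_mem_primeFactors (g i).2
    have : Fact (g i).1.Prime := ⟨hprime⟩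
    have : Fintype (Sylow (g i).1 G) := Fintype.ofFinite _
    rw [Nat.card_pi] at hi
    obtain ⟨P, -, hP⟩ := (hq.prime.dvd_finsetProd_iff _).1 hi
    rw [P.card_eq_multiplicity] at hP
    exact ((Nat.prime_dvd_prime_iff_eq hq hprime).1 (hq.dvd_of_dvd_pow hP)).symm
  let f := E.toMonoidHom.comp (MonoidHom.inl _ _)
  let g := E.toMonoidHom.comp (MonoidHom.inr _ _)
  have hf : Function.Injective f := E.injective.comp fun _ _ h => (Prod.ext_iff.1 h).1
  have hg : Function.Injective g := E.injective.comp fun _ _ h => (Prod.ext_iff.1 h).2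
  let ef := MonoidHom.ofInjective hf
  let eg := MonoidHom.ofInjective hg
  refine ⟨f.range, g.range, ?_, ?_, ⟨E.symm.trans (ef.prodCongr eg)⟩⟩
  · intro q hq h
    rw [← Nat.card_congr ef.toEquiv] at h
    obtain ⟨i, rfl⟩ := hdiv (fun i : {p : (Nat.card G).primeFactors // π p.1} => i.1) q hq h
    exact i.2
  · intro q hq h
    rw [← Nat.card_congr eg.toEquiv] at h
    obtain ⟨i, rfl⟩ := hdiv (fun i : {p : (Nat.card G).primeFactors // ¬ π p.1} => i.1) q hq h
    exact i.2

/-- In a finite nilpotent group, elements of coprime orders commute. -/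
theorem Group.IsNilpotent.commute_of_coprime {G : Type*} [Group G] [Finite G]
    (hG : Group.IsNilpotent G) {x y : G} (h : (orderOf x).Coprime (orderOf y)) : Commute x y := by
  obtain ⟨e⟩ := (Group.isNilpotent_of_finite_tfae (G := G).out 0 4 rfl rfl).1 hG
  suffices Commute (e.symm x) (e.symm y) by simpa using this.map e
  have hx : orderOf (e.symm x) = orderOf x := e.symm.orderOf_eq x
  have hy : orderOf (e.symm y) = orderOf y := e.symm.orderOf_eq y
  rw [← hx, ← hy] at h
  generalize e.symm x = u at h
  generalize e.symm y = v at h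
  refine Pi.commute_iff.2 fun p => Pi.commute_iff.2 fun P => ?_
  have hp := Nat.prime_of_mem_primeFactors p.2
  have : Fact p.1.Prime := ⟨hp⟩
  have key : ∀ w : (∀ p : (Nat.card G).primeFactors, ∀ P : Sylow p G, (P : Subgroup G)),
      w p P ≠ 1 → p.1 ∣ orderOf w := by
    intro w hw
    have h1 : orderOf (w p P) ∣ orderOf w :=
      orderOf_map_dvd ((Pi.evalMonoidHom (fun P : Sylow p.1 G => (P : Subgroup G)) P).comp
        (Pi.evalMonoidHom (fun p : (Nat.card G).primeFactors =>
          ∀ P : Sylow p G, (P : Subgroup G)) p)) w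
    obtain ⟨k, hk⟩ := IsPGroup.iff_orderOf.1 P.isPGroup' (w p P)
    rw [hk] at h1
    refine dvd_trans (dvd_pow_self _ ?_) h1
    rintro rfl
    exact hw (orderOf_eq_one_iff.1 (by simpa using hk))
  by_cases hu : u p P = 1
  · rw [hu]; exact Commute.one_left _
  by_cases hv : v p P = 1
  · rw [hv]; exact Commute.one_right _
  exact absurd (Nat.dvd_gcd (key u hu) (key v hv)) (by rw [h]; exact hp.one_lt.ne' ∘ Nat.dvd_one.1)

/-- An embedding whose source has the full `q`-part of the order induces isomorphisms of Sylow
`q`-subgroups. -/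
theorem Sylow.nonempty_mulEquiv_of_injective {q : ℕ} [Fact q.Prime] {H G : Type*} [Group H]
    [Group G] [Finite G] {f : H →* G} (hf : Function.Injective f)
    (hc : (Nat.card H).factorization q = (Nat.card G).factorization q) (S : Sylow q H)
    (Q : Sylow q G) : Nonempty (S ≃* Q) := by
  have : Finite H := Finite.of_injective f hf
  let T : Sylow q G := Sylow.ofCard ((S : Subgroup H).map f) <| by
    rw [Subgroup.card_map_of_injective hf, ← hc]
    exact S.card_eq_multiplicity
  exact ⟨((S : Subgroup H).equivMapOfInjective f hf).trans (T.equiv Q)⟩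

/-- The subgroups of order `p` of a normal Sylow `p`-subgroup are those of the group. -/
theorem Sylow.natCard_subgroups_card_eq {p : ℕ} [Fact p.Prime] {G : Type*} [Group G] [Finite G]
    (P : Sylow p G) [P.Normal] :
    Nat.card {K : Subgroup P // Nat.card K = p} = Nat.card {K : Subgroup G // Nat.card K = p} := by
  refine Nat.card_congr (Equiv.ofBijective (fun K => ⟨K.1.map (P : Subgroup G).subtype, by
    rw [Subgroup.card_map_of_injective (Subgroup.subtype_injective _), K.2]⟩) ⟨?_, ?_⟩)
  · intro K L h
    exact Subtype.ext (Subgroup.map_injective (Subgroup.subtype_injective _) (congrArg Subtype.val h))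
  · rintro ⟨K, hK⟩
    have hKp : IsPGroup p K := IsPGroup.of_card (n := 1) (by simpa using hK)
    obtain ⟨Q, hQ⟩ := hKp.exists_le_sylow
    have := Sylow.unique_of_normal P inferInstance
    rw [Subsingleton.elim Q P] at hQ
    refine ⟨⟨K.subgroupOf P, ?_⟩, Subtype.ext ?_⟩
    · rw [Nat.card_congr (Subgroup.subgroupOfEquivOfLe hQ).toEquiv, hK]
    · exact Subgroup.map_subgroupOf_eq_of_le hQ

/-! ### Maximal cyclic subgroups of the quaternion group -/

namespace QuaternionGroup

variable {m : ℕ}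

theorem a_pow (i : ZMod (2 * m)) (n : ℕ) : a i ^ n = a ((n : ZMod (2 * m)) * i) := by
  induction n with
  | zero => simp
  | succ n ih => rw [pow_succ, ih, a_mul_a]; congr 1; push_cast; ring

theorem xa_pow_three (i : ZMod (2 * m)) : xa i ^ 3 = xa (i + (m : ZMod (2 * m))) := by
  have h : (m : ZMod (2 * m)) + m = 0 := by
    rw [← two_mul]; exact_mod_cast ZMod.natCast_self (2 * m)
  rw [pow_succ, xa_sq, a_mul_xa]
  congr 1
  linear_combination -h

theorem a_mem_zpowers_a_one [NeZero m] (i : ZMod (2 * m)) : a i ∈ Subgroup.zpowers (a 1) :=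
  ⟨(i.val : ℤ), by
    change a 1 ^ (i.val : ℤ) = a i
    rw [zpow_natCast, a_one_pow, ZMod.natCast_zmod_val]⟩

theorem exists_eq_a_of_mem_zpowers_a [NeZero m] {i : ZMod (2 * m)} {y : QuaternionGroup m}
    (h : y ∈ Subgroup.zpowers (a i)) : ∃ j, y = a j := by
  obtain ⟨n, rfl⟩ := mem_powers_iff_mem_zpowers.2 h
  exact ⟨_, a_pow i n⟩

theorem eq_of_mem_zpowers_xa [NeZero m] {i : ZMod (2 * m)} {y : QuaternionGroup m}
    (h : y ∈ Subgroup.zpowers (xa i)) : y = a 0 ∨ y = a m ∨ y = xa i ∨ y = xa (i + (m : ZMod (2 * m))) := by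
  obtain ⟨n, rfl⟩ := mem_powers_iff_mem_zpowers.2 h
  have h4 : n % 4 < 4 := Nat.mod_lt _ (by norm_num)
  have hn : xa i ^ n = xa i ^ (n % 4) := by rw [← orderOf_xa i, pow_mod_orderOf]
  simp only [hn]
  interval_cases n % 4
  · left; simp
  · right; right; left; simp
  · right; left; exact xa_sq i
  · right; right; right; exact xa_pow_three i

/-- Maximality of ⟨xa i⟩: a cyclic group containing xa i is generated by xa i or by its inverse. -/
theorem mem_zpowers_xa_of_cyclicallyRelated [NeZero m] {i : ZMod (2 * m)} {y : QuaternionGroup m}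
    (h : CyclicallyRelated (xa i) y) : y ∈ Subgroup.zpowers (xa i) := by
  obtain ⟨w, hi, hy⟩ := h
  cases w with
  | a j =>
    obtain ⟨l, hl⟩ := exists_eq_a_of_mem_zpowers_a hi
    cases hl
  | xa j =>
    have hz : xa j ∈ Subgroup.zpowers (xa i) := by
      rcases eq_of_mem_zpowers_xa hi with h | h | h | h
      · cases h
      · cases h
      · rw [h]; exact Subgroup.mem_zpowers _
      · refine ⟨3, ?_⟩
        rw [h, ← xa_pow_three]
        change (xa j ^ 3) ^ (3 : ℤ) = xa j
        have h8 : xa j ^ 8 = 1 := by rw [show 8 = 4 * 2 from rfl, pow_mul, xa_pow_four, one_pow]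
        rw [show (3 : ℤ) = ((3 : ℕ) : ℤ) from rfl, zpow_natCast, ← pow_mul,
          show 3 * 3 = 8 + 1 from rfl, pow_succ, h8, one_mul]
    exact (Subgroup.zpowers_le.2 hz) hy

/-- Maximality of ⟨a 1⟩: the only a-elements of ⟨xa j⟩ are a 0 and a m, and 1 is neither 0 nor m
modulo 2m once m ≥ 2. -/
theorem exists_eq_a_of_cyclicallyRelated_a_one (hm : 2 ≤ m) {y : QuaternionGroup m}
    (h : CyclicallyRelated (a 1) y) : ∃ j, y = a j := by
  have : NeZero m := ⟨by omega⟩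
  obtain ⟨w, hi, hy⟩ := h
  cases w with
  | a j => exact exists_eq_a_of_mem_zpowers_a hy
  | xa j =>
    exfalso
    have hcast : ∀ l < 2 * m, l ≠ 1 → (1 : ZMod (2 * m)) ≠ (l : ZMod (2 * m)) := by
      intro l hl hl1 h
      have : ((1 : ℕ) : ZMod (2 * m)) = (l : ZMod (2 * m)) := by simpa using h
      rw [ZMod.natCast_eq_natCast_iff', Nat.mod_eq_of_lt hl, Nat.mod_eq_of_lt (by omega)] at this
      exact hl1 this.symm
    rcases eq_of_mem_zpowers_xa hi with h | h | h | h
    · exact hcast 0 (by omega) (by omega) (by simpa using a.inj h)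
    · exact hcast m (by omega) (by omega) (a.inj h)
    · cases h
    · cases h

theorem cyclicallyRelated_a_natCast [NeZero m] (u : QuaternionGroup m) :
    CyclicallyRelated (a m) u := by
  cases u with
  | a i => exact ⟨a 1, a_mem_zpowers_a_one _, a_mem_zpowers_a_one _⟩
  | xa i => exact .of_mem_zpowers ⟨2, by exact_mod_cast xa_sq i⟩

/-- Generators of the maximal cyclic subgroups of the generalized quaternion group. -/
def maxCyclicGenerator (m : ℕ) : Option (Fin m) → QuaternionGroup m
  | none => a 1
  | some j => xa (j : ℕ)

theorem exists_cyclicallyRelated_maxCyclicGenerator [NeZero m] (q : QuaternionGroup m) :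
    ∃ i, CyclicallyRelated q (maxCyclicGenerator m i) := by
  cases q with
  | a i => exact ⟨none, .of_mem_zpowers (a_mem_zpowers_a_one i)⟩
  | xa i =>
    have hv : i.val < 2 * m := ZMod.val_lt i
    by_cases h : i.val < m
    · refine ⟨some ⟨i.val, h⟩, ?_⟩
      simpa [maxCyclicGenerator] using CyclicallyRelated.refl (xa i)
    -- xa i and xa (i - m) are inverse to each other, so indices below m suffice.
    · refine ⟨some ⟨i.val - m, by omega⟩, .of_mem_zpowers ⟨3, ?_⟩⟩
      have h3 := xa_pow_three (((i.val - m : ℕ) : ZMod (2 * m)))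
      rw [← Nat.cast_add, Nat.sub_add_cancel (not_lt.1 h), ZMod.natCast_zmod_val] at h3
      exact_mod_cast h3

theorem exists_not_cyclicallyRelated_maxCyclicGenerator (hm : 2 ≤ m) (i : Option (Fin m)) :
    ∃ u, ¬ CyclicallyRelated (maxCyclicGenerator m i) u := by
  have key : ∀ j, ¬ CyclicallyRelated (a 1 : QuaternionGroup m) (xa j) := fun j h => by
    obtain ⟨l, hl⟩ := exists_eq_a_of_cyclicallyRelated_a_one hm h
    cases hl
  cases i with
  | none => exact ⟨xa 0, key 0⟩
  | some j => exact ⟨a 1, fun h => key _ h.symm⟩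

/-- An element lying in two distinct maximal cyclic subgroups is related to everything. -/
theorem cyclicallyRelated_of_maxCyclicGenerator (hm : 2 ≤ m) {d : QuaternionGroup m}
    {i j : Option (Fin m)} (hij : i ≠ j) (hi : CyclicallyRelated d (maxCyclicGenerator m i))
    (hj : CyclicallyRelated d (maxCyclicGenerator m j)) (u : QuaternionGroup m) :
    CyclicallyRelated d u := by
  have : NeZero m := ⟨by omega⟩
  suffices d = a 0 ∨ d = a m by
    rcases this with rfl | rfl
    · exact .one_left u
    · exact cyclicallyRelated_a_natCast u
  have mixed : ∀ l : Fin m, CyclicallyRelated d (a 1) → CyclicallyRelated d (xa (l : ℕ)) →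
      d = a 0 ∨ d = a m := by
    intro l h1 h2
    obtain ⟨c, rfl⟩ := exists_eq_a_of_cyclicallyRelated_a_one hm h1.symm
    rcases eq_of_mem_zpowers_xa (mem_zpowers_xa_of_cyclicallyRelated h2.symm) with h | h | h | h
    · exact .inl h
    · exact .inr h
    · cases h
    · cases h
  have hcast : ∀ s t : ℕ, s < 2 * m → t < 2 * m → s ≠ t →
      (s : ZMod (2 * m)) ≠ (t : ZMod (2 * m)) := by
    intro s t hs ht hst h
    rw [ZMod.natCast_eq_natCast_iff', Nat.mod_eq_of_lt hs, Nat.mod_eq_of_lt ht] at h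
    exact hst h
  cases i with
  | none =>
    cases j with
    | none => exact absurd rfl hij
    | some j => exact mixed j hi hj
  | some i =>
    cases j with
    | none => exact mixed i hj hi
    | some j =>
      have hne : (i : ℕ) ≠ j := fun h => hij (congrArg some (Fin.ext h))
      have hi' := i.2
      have hj' := j.2
      rcases eq_of_mem_zpowers_xa (mem_zpowers_xa_of_cyclicallyRelated hi.symm) with h | h | h | h
      · exact .inl h
      · exact .inr h
      all_goals
        rcases eq_of_mem_zpowers_xa (mem_zpowers_xa_of_cyclicallyRelated hj.symm) with
          h' | h' | h' | h'
        · exact .inl h'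
        · exact .inr h'
        all_goals
          have h2 := xa.inj (h.symm.trans h')
          exfalso
      · exact hcast i j (by omega) (by omega) hne h2
      · exact hcast i (j + m) (by omega) (by omega) (by omega) (by exact_mod_cast h2)
      · exact hcast (i + m) j (by omega) (by omega) (by omega) (by exact_mod_cast h2)
      · exact hcast i j (by omega) (by omega) hne (add_right_cancel h2)

end QuaternionGroup

/-! ### Dominating sets as sets of group elements -/

theorem mem_dominatingVertices_enhancedPowerGraph {G : Type*} [Group G] {v : G} :
    v ∈ dominatingVertices (enhancedPowerGraph G) ↔ ∀ u, CyclicallyRelated v u := by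
  refine ⟨fun h u => ?_, fun h u hu => ⟨hu.symm, h u⟩⟩
  by_cases huv : u = v
  · exact huv ▸ .refl u
  · exact (h u huv).2

/-- Dominating sets of the proper enhanced power graph, as sets of group elements. -/
structure IsProperDominatingSet {G : Type*} [Group G] (D : Set G) : Prop where
  not_forall : ∀ d ∈ D, ¬ ∀ u, CyclicallyRelated d u
  exists_mem : ∀ v : G, (¬ ∀ u, CyclicallyRelated v u) → ∃ d ∈ D, CyclicallyRelated v d

/-- The relation is reflexive, so members of D dominate themselves and neither the subtype of
vertices nor the condition u ≠ v matters. -/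
theorem le_dominationNumber_properEnhancedPowerGraph {G : Type*} [Group G] {m : ℕ∞}
    (h : ∀ D : Set G, IsProperDominatingSet D → m ≤ D.encard) :
    m ≤ dominationNumber (properEnhancedPowerGraph G) := by
  refine le_iInf₂ fun D hD => ?_
  rw [← Subtype.val_injective.encard_image]
  refine h _ ⟨?_, fun v hv => ?_⟩
  · rintro _ ⟨d, -, rfl⟩ hd
    exact d.2 (mem_dominatingVertices_enhancedPowerGraph.2 hd)
  · have hv' : v ∈ (dominatingVertices (enhancedPowerGraph G))ᶜ :=
      fun h => hv (mem_dominatingVertices_enhancedPowerGraph.1 h)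
    by_cases hmem : (⟨v, hv'⟩ : ((dominatingVertices (enhancedPowerGraph G))ᶜ : Set G)) ∈ D
    · exact ⟨v, ⟨_, hmem, rfl⟩, .refl v⟩
    · obtain ⟨d, hd, hadj⟩ := hD _ hmem
      exact ⟨d, ⟨d, hd, rfl⟩, hadj.2⟩

theorem IsProperDominatingSet.dominationNumber_le {G : Type*} [Group G] {D : Set G}
    (hD : IsProperDominatingSet D) :
    dominationNumber (properEnhancedPowerGraph G) ≤ D.encard := by
  let D' : Set ((dominatingVertices (enhancedPowerGraph G))ᶜ : Set G) := Subtype.val ⁻¹' D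
  refine (iInf₂_le D' ?_).trans ?_
  · intro v hv
    obtain ⟨d, hd, hr⟩ := hD.exists_mem v fun h =>
      v.2 (mem_dominatingVertices_enhancedPowerGraph.2 h)
    refine ⟨⟨d, fun h => hD.not_forall d hd (mem_dominatingVertices_enhancedPowerGraph.1 h)⟩, hd,
      fun h => hv ?_, hr⟩
    change (v : G) ∈ D
    rw [show (v : G) = d from h]
    exact hd
  · rw [← Subtype.val_injective.encard_image]
    exact Set.encard_le_encard (Set.image_preimage_subset _ _)

theorem IsProperDominatingSet.image {G H : Type*} [Group G] [Group H] (e : G ≃* H) {D : Set G}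
    (hD : IsProperDominatingSet D) : IsProperDominatingSet (e '' D) := by
  have key : ∀ v, (∀ u, CyclicallyRelated (e v) u) ↔ ∀ u, CyclicallyRelated v u := fun v =>
    ⟨fun h u => (CyclicallyRelated.map_iff e).1 (h (e u)), fun h u => by
      simpa using (CyclicallyRelated.map_iff e).2 (h (e.symm u))⟩
  refine ⟨?_, fun v hv => ?_⟩
  · rintro _ ⟨d, hd, rfl⟩
    exact (key d).not.2 (hD.not_forall d hd)
  · obtain ⟨v, rfl⟩ := e.surjective v
    obtain ⟨d, hd, h⟩ := hD.exists_mem v ((key v).not.1 hv)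
    exact ⟨e d, ⟨d, hd, rfl⟩, (CyclicallyRelated.map_iff e).2 h⟩

theorem dominationNumber_properEnhancedPowerGraph_congr {G H : Type*} [Group G] [Group H]
    (e : G ≃* H) : dominationNumber (properEnhancedPowerGraph G) =
      dominationNumber (properEnhancedPowerGraph H) := by
  refine le_antisymm ?_ ?_
  · refine le_dominationNumber_properEnhancedPowerGraph fun D hD => ?_
    rw [← e.symm.injective.encard_image]
    exact (hD.image e.symm).dominationNumber_le
  · refine le_dominationNumber_properEnhancedPowerGraph fun D hD => ?_
    rw [← e.injective.encard_image]
    exact (hD.image e).dominationNumber_le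

/-! ### Selecting elements missed by a small set -/

/-- If each member of `D` excludes at most one index and `D` is smaller than the index type, some
index is not excluded. -/
theorem exists_forall_not_of_encard_lt {α ι : Type*} [Finite ι] {D : Set α} {R : α → ι → Prop}
    (hR : ∀ d ∈ D, ∀ i j, R d i → R d j → i = j) (h : D.encard < Nat.card ι) :
    ∃ i, ∀ d ∈ D, ¬ R d i := by
  by_contra! hcon
  choose f hf hRf using hcon
  have hinj : Function.Injective f := fun i j hij =>
    hR (f i) (hf i) i j (hRf i) (hij ▸ hRf j)
  have hle : (Set.univ : Set ι).encard ≤ D.encard := by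
    rw [← hinj.encard_image]
    exact Set.encard_le_encard (by rintro _ ⟨i, -, rfl⟩; exact hf i)
  rw [Set.encard_univ, ENat.card_eq_coe_natCard] at hle
  exact absurd h (not_lt.2 hle)

/-- In a finite nilpotent group, elements of distinct prime orders are powers of one element. -/
theorem Group.IsNilpotent.exists_forall_mem_zpowers {A : Type*} [Group A] [Finite A]
    (hA : Group.IsNilpotent A) (c : ℕ → A) (s : Finset ℕ)
    (hc : ∀ p ∈ s, p.Prime ∧ orderOf (c p) = p) :
    ∃ v : A, orderOf v = ∏ p ∈ s, p ∧ ∀ p ∈ s, c p ∈ Subgroup.zpowers v := by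
  classical
  induction s using Finset.induction_on with
  | empty => exact ⟨1, by simp, by simp⟩
  | insert q s hq ih =>
    obtain ⟨v, hv, hmem⟩ := ih fun p hp => hc p (Finset.mem_insert_of_mem hp)
    obtain ⟨hqp, hqo⟩ := hc q (Finset.mem_insert_self q s)
    have hco : (orderOf (c q)).Coprime (orderOf v) := by
      rw [hqo, hv]
      refine Nat.Coprime.prod_right fun p hp => (Nat.coprime_primes hqp
        (hc p (Finset.mem_insert_of_mem hp)).1).2 ?_
      rintro rfl
      exact hq hp
    have hcomm := hA.commute_of_coprime hco
    refine ⟨c q * v, ?_, fun p hp => ?_⟩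
    · rw [hcomm.orderOf_mul_eq_mul_orderOf_of_coprime hco, hqo, hv, Finset.prod_insert hq]
    · rcases Finset.mem_insert.1 hp with rfl | hp
      · exact hcomm.mem_zpowers_mul_of_coprime hco
      · have := hcomm.symm.mem_zpowers_mul_of_coprime hco.symm
        rw [← hcomm.eq, ← Subgroup.zpowers_le] at this
        exact this (hmem p hp)

/-! ### Bounds for the product A × B × Q -/

section Product

variable {A B : Type*} [Group A] [Group B] [Finite A] [Finite B] {m : ℕ}

theorem CyclicallyRelated.prod_prod_iff {Q : Type*} [Group Q] [Finite Q]
    (hAB : (Nat.card A).Coprime (Nat.card B)) (hAQ : (Nat.card A).Coprime (Nat.card Q))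
    (hBQ : (Nat.card B).Coprime (Nat.card Q)) {u v : A × B × Q} :
    CyclicallyRelated u v ↔ CyclicallyRelated u.1 v.1 ∧ CyclicallyRelated u.2.1 v.2.1 ∧
      CyclicallyRelated u.2.2 v.2.2 := by
  rw [CyclicallyRelated.prod_iff (by rw [Nat.card_prod]; exact hAB.mul_right hAQ),
    CyclicallyRelated.prod_iff hBQ]

theorem dominationNumber_prod_quaternionGroup_le (hm : 2 ≤ m) [IsCyclic B]
    (hAB : (Nat.card A).Coprime (Nat.card B))
    (hAQ : (Nat.card A).Coprime (Nat.card (QuaternionGroup m)))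
    (hBQ : (Nat.card B).Coprime (Nat.card (QuaternionGroup m))) :
    dominationNumber (properEnhancedPowerGraph (A × B × QuaternionGroup m)) ≤ (m + 1 : ℕ) := by
  have : NeZero m := ⟨by omega⟩
  let D : Set (A × B × QuaternionGroup m) :=
    Set.range fun i => (1, 1, QuaternionGroup.maxCyclicGenerator m i)
  have hD : IsProperDominatingSet D := by
    refine ⟨?_, fun v _ => ?_⟩
    · rintro _ ⟨i, rfl⟩ h
      obtain ⟨u, hu⟩ := QuaternionGroup.exists_not_cyclicallyRelated_maxCyclicGenerator hm i
      exact hu ((CyclicallyRelated.prod_prod_iff hAB hAQ hBQ).1 (h (1, 1, u))).2.2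
    · obtain ⟨i, hi⟩ := QuaternionGroup.exists_cyclicallyRelated_maxCyclicGenerator v.2.2
      exact ⟨_, ⟨i, rfl⟩, (CyclicallyRelated.prod_prod_iff hAB hAQ hBQ).2
        ⟨(CyclicallyRelated.one_left _).symm, .of_isCyclic _ _, hi⟩⟩
  refine hD.dominationNumber_le.trans ?_
  change (Set.range _).encard ≤ _
  rw [← Set.image_univ]
  refine (Set.encard_image_le _ _).trans ?_
  simp [Set.encard_univ]

/-- Generators of the subgroups of order p, with trivial other coordinates, dominate; having two
such subgroups keeps each generator from being a deleted vertex. -/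
theorem dominationNumber_prod_le_card_subgroups {Q : Type*} [Group Q] [Finite Q]
    (hA : Group.IsNilpotent A)
    (hAB : (Nat.card A).Coprime (Nat.card B)) (hAQ : (Nat.card A).Coprime (Nat.card Q))
    (hBQ : (Nat.card B).Coprime (Nat.card Q)) {p : ℕ} (hp : p.Prime)
    (hnu : ¬ ∀ H K : Subgroup A, Nat.card H = p → Nat.card K = p → H = K) :
    dominationNumber (properEnhancedPowerGraph (A × B × Q)) ≤
      (Nat.card {K : Subgroup A // Nat.card K = p} : ℕ) := by
  have : Fact p.Prime := ⟨hp⟩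
  have hgen : ∀ K : {K : Subgroup A // Nat.card K = p}, ∃ c : A, Subgroup.zpowers c = K.1 := by
    intro K
    have : IsCyclic K.1 := isCyclic_of_prime_card K.2
    exact Subgroup.isCyclic_iff_exists_zpowers_eq_top K.1 |>.1 this
  choose c hc using hgen
  have hord : ∀ K, orderOf (c K) = p := fun K => by rw [← Nat.card_zpowers, hc, K.2]
  let D : Set (A × B × Q) := Set.range fun K => (c K, 1, 1)
  have hD : IsProperDominatingSet D := by
    refine ⟨?_, fun v _ => ?_⟩
    · rintro _ ⟨K, rfl⟩ h
      refine hnu fun L M hL hM => ?_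
      have key : ∀ L : {K : Subgroup A // Nat.card K = p}, K.1 = L.1 := by
        intro L
        obtain ⟨w, h1, h2⟩ :=
          ((CyclicallyRelated.prod_prod_iff hAB hAQ hBQ).1 (h (c L, 1, 1))).1
        refine Subgroup.eq_of_natCard_eq_of_le_zpowers (w := w) ?_ ?_ (K.2.trans L.2.symm)
        · rw [← hc]; exact Subgroup.zpowers_le.2 h1
        · rw [← hc]; exact Subgroup.zpowers_le.2 h2
      exact (key ⟨L, hL⟩).symm.trans (key ⟨M, hM⟩)
    · obtain ⟨K, hK⟩ : ∃ K, CyclicallyRelated v.1 (c K) := by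
        by_cases hpv : p ∣ orderOf v.1
        · have hx : orderOf (v.1 ^ (orderOf v.1 / p)) = p :=
            orderOf_pow_orderOf_div (orderOf_pos _).ne' hpv
          refine ⟨⟨Subgroup.zpowers (v.1 ^ (orderOf v.1 / p)), by rw [Nat.card_zpowers, hx]⟩,
            (CyclicallyRelated.of_mem_zpowers ?_).symm⟩
          rw [← Subgroup.zpowers_le, hc, Subgroup.zpowers_le]
          exact Subgroup.npow_mem_zpowers _ _
        · obtain ⟨K, hK⟩ : ∃ K : Subgroup A, Nat.card K = p := by
            by_contra! h
            exact hnu fun H K hH _ => absurd hH (h H)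
          refine ⟨⟨K, hK⟩, ?_⟩
          have hco : (orderOf v.1).Coprime (orderOf (c ⟨K, hK⟩)) := by
            rw [hord]
            exact ((Nat.Prime.coprime_iff_not_dvd hp).2 hpv).symm
          exact .of_commute_of_coprime (hA.commute_of_coprime hco) hco
      exact ⟨_, ⟨K, rfl⟩, (CyclicallyRelated.prod_prod_iff hAB hAQ hBQ).2
        ⟨hK, (CyclicallyRelated.one_left _).symm, (CyclicallyRelated.one_left _).symm⟩⟩
  refine hD.dominationNumber_le.trans ?_
  change (Set.range _).encard ≤ _
  rw [← Set.image_univ]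
  refine (Set.encard_image_le _ _).trans ?_
  rw [Set.encard_univ, ENat.card_eq_coe_natCard]

theorem le_dominationNumber_prod_quaternionGroup (hm : 2 ≤ m) [IsCyclic B]
    (hA : Group.IsNilpotent A)
    (hAB : (Nat.card A).Coprime (Nat.card B))
    (hAQ : (Nat.card A).Coprime (Nat.card (QuaternionGroup m)))
    (hBQ : (Nat.card B).Coprime (Nat.card (QuaternionGroup m))) {r : ℕ} (hr : r ≤ m + 1)
    (hrA : ∀ p : ℕ, p.Prime → p ∣ Nat.card A →
      r ≤ Nat.card {K : Subgroup A // Nat.card K = p}) :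
    (r : ℕ∞) ≤ dominationNumber (properEnhancedPowerGraph (A × B × QuaternionGroup m)) := by
  have : NeZero m := ⟨by omega⟩
  refine le_dominationNumber_properEnhancedPowerGraph fun D hD => ?_
  by_contra! hlt
  have hC : ∀ p : ℕ, ∃ c : A, p.Prime → p ∣ Nat.card A → orderOf c = p ∧
      ∀ d ∈ D, ¬ Subgroup.zpowers c ≤ Subgroup.zpowers d.1 := by
    intro p
    by_cases hp : p.Prime ∧ p ∣ Nat.card A
    · obtain ⟨⟨K, hK⟩, hKD⟩ := exists_forall_not_of_encard_lt (D := D)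
        (R := fun d (K : {K : Subgroup A // Nat.card K = p}) => K.1 ≤ Subgroup.zpowers d.1)
        (fun d _ K L hK hL => Subtype.ext
          (Subgroup.eq_of_natCard_eq_of_le_zpowers hK hL (K.2.trans L.2.symm)))
        (hlt.trans_le (by exact_mod_cast hrA p hp.1 hp.2))
      have : Fact p.Prime := ⟨hp.1⟩
      have hcyc : IsCyclic K := isCyclic_of_prime_card hK
      obtain ⟨c, rfl⟩ := (Subgroup.isCyclic_iff_exists_zpowers_eq_top K).1 hcyc
      exact ⟨c, fun _ _ => ⟨by rw [← Nat.card_zpowers, hK], hKD⟩⟩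
    -- Dummy value, making c total; only prime divisors of |A| are used.
    · exact ⟨1, fun h1 h2 => absurd ⟨h1, h2⟩ hp⟩
  choose c hc using hC
  obtain ⟨v, -, hv⟩ := hA.exists_forall_mem_zpowers c (Nat.card A).primeFactors fun p hp =>
    ⟨Nat.prime_of_mem_primeFactors hp,
      (hc p (Nat.prime_of_mem_primeFactors hp) (Nat.dvd_of_mem_primeFactors hp)).1⟩
  -- Third coordinates dominating in Q are left out, as they would exclude every index; any other
  -- one excludes at most one.
  obtain ⟨i, hi⟩ := exists_forall_not_of_encard_lt (D := D)
    (R := fun d i => (¬ ∀ u, CyclicallyRelated d.2.2 u) ∧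
      CyclicallyRelated d.2.2 (QuaternionGroup.maxCyclicGenerator m i))
    (fun d _ i j hi hj => by
      by_contra hij
      exact hi.1 (QuaternionGroup.cyclicallyRelated_of_maxCyclicGenerator hm hij hi.2 hj.2))
    (hlt.trans_le (by simpa using (by exact_mod_cast hr : (r : ℕ∞) ≤ m + 1)))
  obtain ⟨d, hd, hrel⟩ :=
    hD.exists_mem (v, 1, QuaternionGroup.maxCyclicGenerator m i) fun h => by
      obtain ⟨u, hu⟩ := QuaternionGroup.exists_not_cyclicallyRelated_maxCyclicGenerator hm i
      exact hu ((CyclicallyRelated.prod_prod_iff hAB hAQ hBQ).1 (h (1, 1, u))).2.2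
  obtain ⟨hrel₁, -, hrel₂⟩ := (CyclicallyRelated.prod_prod_iff hAB hAQ hBQ).1 hrel
  refine hD.not_forall d hd fun u => (CyclicallyRelated.prod_prod_iff hAB hAQ hBQ).2
    ⟨?_, .of_isCyclic _ _, ?_⟩
  · by_cases hd1 : d.1 = 1
    · rw [hd1]; exact .one_left _
    · exfalso
      obtain ⟨p, hp, hpd⟩ := Nat.exists_prime_and_dvd (mt orderOf_eq_one_iff.1 hd1)
      have hpA : p ∣ Nat.card A := hpd.trans (orderOf_dvd_natCard _)
      obtain ⟨hcp, hcD⟩ := hc p hp hpA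
      obtain ⟨w, hw1, hw2⟩ := hrel₁
      have hx : orderOf (d.1 ^ (orderOf d.1 / p)) = p :=
        orderOf_pow_orderOf_div (orderOf_pos _).ne' hpd
      have hxd : Subgroup.zpowers (d.1 ^ (orderOf d.1 / p)) ≤ Subgroup.zpowers d.1 :=
        Subgroup.zpowers_le.2 (Subgroup.npow_mem_zpowers _ _)
      have hcv : Subgroup.zpowers (c p) ≤ Subgroup.zpowers v :=
        Subgroup.zpowers_le.2 (hv p (Nat.mem_primeFactors.2 ⟨hp, hpA, Nat.card_pos.ne'⟩))
      -- ⟨c p⟩ and the subgroup of order p in ⟨d.1⟩ both lie in ⟨w⟩, hence coincide, against the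
      -- choice of c p.
      refine hcD d hd (le_of_eq_of_le ?_ hxd)
      exact Subgroup.eq_of_natCard_eq_of_le_zpowers (hcv.trans (Subgroup.zpowers_le.2 hw1))
        (hxd.trans (Subgroup.zpowers_le.2 hw2)) (by rw [Nat.card_zpowers, Nat.card_zpowers, hcp, hx])
  · by_contra hcon
    exact hi d hd ⟨fun h => hcon (h _), hrel₂.symm⟩

end Product

/-! ### Values of the domination number -/

theorem coprime_natCard_genQuaternion {n k : ℕ} (h : n.Coprime 2) :
    n.Coprime (Nat.card (GenQuaternion k)) := by
  rw [Nat.card_eq_fintype_card, QuaternionGroup.card, show 4 = 2 ^ 2 from rfl, ← pow_add]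
  exact h.pow_right _

theorem two_le_two_pow_sub_two {k : ℕ} (hk : 3 ≤ k) : 2 ≤ 2 ^ (k - 2) :=
  Nat.le_self_pow (by omega) 2

/-- Case A trivial: no prime divides |A|, so r = m + 1 is admissible in the lower bound. -/
theorem dominationNumber_of_mulEquiv_isCyclic_prod {G B : Type*} [Group G] [Group B] [Finite B]
    [IsCyclic B] {k : ℕ} (hk : 3 ≤ k) (hB : (Nat.card B).Coprime 2)
    (e : G ≃* B × GenQuaternion k) :
    dominationNumber (properEnhancedPowerGraph G) = ((2 ^ (k - 2) + 1 : ℕ) : ℕ∞) := by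
  have e' : G ≃* Unit × B × GenQuaternion k := e.trans MulEquiv.uniqueProd.symm
  have h1 : Nat.card Unit = 1 := by simp
  have hm := two_le_two_pow_sub_two hk
  have hBQ := coprime_natCard_genQuaternion (k := k) hB
  rw [dominationNumber_properEnhancedPowerGraph_congr e']
  refine le_antisymm (dominationNumber_prod_quaternionGroup_le hm (by simp) (by simp) hBQ)
    (le_dominationNumber_prod_quaternionGroup hm inferInstance (by simp) (by simp) hBQ le_rfl ?_)
  intro p hp hd
  rw [h1] at hd
  exact absurd (Nat.dvd_one.1 hd) hp.one_lt.ne'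

namespace IsNilpotentWithoutCyclicOrQuaternionSylow

variable {A : Type*} [Group A]

theorem minNumPrimeOrderSubgroups_le (hA : IsNilpotentWithoutCyclicOrQuaternionSylow A) {p : ℕ}
    (hp : p.Prime) (hd : p ∣ Nat.card A) :
    minNumPrimeOrderSubgroups A ≤ Nat.card {K : Subgroup A // Nat.card K = p} := by
  have := hA.finite
  have := hA.nilpotent
  have : Fact p.Prime := ⟨hp⟩
  let P : Sylow p A := default
  exact Nat.sInf_le ⟨p, hp, hd, P, P.natCard_subgroups_card_eq.symm⟩

theorem exists_minNumPrimeOrderSubgroups_eq (hA : IsNilpotentWithoutCyclicOrQuaternionSylow A)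
    (hodd : (Nat.card A).Coprime 2) :
    ∃ p : ℕ, p.Prime ∧
      minNumPrimeOrderSubgroups A = Nat.card {K : Subgroup A // Nat.card K = p} ∧
      ¬ ∀ H K : Subgroup A, Nat.card H = p → Nat.card K = p → H = K := by
  have := hA.finite
  have := hA.nontrivial
  have := hA.nilpotent
  obtain ⟨p, hp, hd, P, hP⟩ : minNumPrimeOrderSubgroups A ∈ {r : ℕ | ∃ p : ℕ, p.Prime ∧
      p ∣ Nat.card A ∧ ∃ P : Sylow p A, r = Nat.card {K : Subgroup P // Nat.card K = p}} := by
    -- The infimum is attained because a nontrivial group has a prime divisor of its order.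
    refine Nat.sInf_mem ?_
    obtain ⟨p, hp, hd⟩ := Nat.exists_prime_and_dvd (Finite.one_lt_card (α := A)).ne'
    exact ⟨_, p, hp, hd, default, rfl⟩
  have : Fact p.Prime := ⟨hp⟩
  have hp2 : p ≠ 2 := by
    rintro rfl
    exact absurd (Nat.dvd_gcd hd dvd_rfl) (by rw [hodd]; decide)
  refine ⟨p, hp, hP.trans P.natCard_subgroups_card_eq, fun h => (hA.sylow p hp hd P).1 ?_⟩
  refine P.isPGroup'.isCyclic_of_subsingleton_card_eq hp2 fun H K hH hK => ?_
  apply Subgroup.map_injective (P : Subgroup A).subtype_injective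
  apply h <;> rwa [Subgroup.card_map_of_injective (Subgroup.subtype_injective _)]

end IsNilpotentWithoutCyclicOrQuaternionSylow

theorem dominationNumber_of_mulEquiv_prod {G A B : Type*} [Group G] [Group A] [Group B] [Finite B]
    [IsCyclic B] {k : ℕ} (hk : 3 ≤ k) (hA : IsNilpotentWithoutCyclicOrQuaternionSylow A)
    (hAB : (Nat.card A).Coprime (Nat.card B)) (hA2 : (Nat.card A).Coprime 2)
    (hB : (Nat.card B).Coprime 2) (e : G ≃* A × B × GenQuaternion k) :
    dominationNumber (properEnhancedPowerGraph G) =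
      ((min (minNumPrimeOrderSubgroups A) (2 ^ (k - 2) + 1) : ℕ) : ℕ∞) := by
  have := hA.finite
  have hm := two_le_two_pow_sub_two hk
  have hAQ := coprime_natCard_genQuaternion (k := k) hA2
  have hBQ := coprime_natCard_genQuaternion (k := k) hB
  rw [dominationNumber_properEnhancedPowerGraph_congr e]
  refine le_antisymm ?_ ?_
  · rw [(Nat.mono_cast (α := ℕ∞)).map_min]
    refine le_min ?_ (dominationNumber_prod_quaternionGroup_le hm hAB hAQ hBQ)
    obtain ⟨p, hp, hmin, hnu⟩ := hA.exists_minNumPrimeOrderSubgroups_eq hA2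
    rw [hmin]
    exact dominationNumber_prod_le_card_subgroups hA.nilpotent hAB hAQ hBQ hp hnu
  · exact le_dominationNumber_prod_quaternionGroup hm hA.nilpotent hAB hAQ hBQ (min_le_right _ _)
      fun p hp hd => (min_le_left _ _).trans (hA.minNumPrimeOrderSubgroups_le hp hd)

/-! ### Structure of the group -/

theorem IsPGroup.not_isGenQuaternion {p : ℕ} [Fact p.Prime] (hp2 : p ≠ 2) {P : Type*} [Group P]
    [Finite P] (hP : IsPGroup p P) : ¬ IsGenQuaternion P := by
  rintro ⟨k, -, ⟨e⟩⟩
  obtain ⟨n, hn⟩ := IsPGroup.iff_card.1 hP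
  rw [Nat.card_congr e.toEquiv, Nat.card_eq_fintype_card, QuaternionGroup.card] at hn
  have h2 : 2 ∣ p ^ n := hn ▸ (Dvd.intro _ rfl : 2 ∣ 2 * 2).mul_right _
  exact hp2 ((Nat.prime_dvd_prime_iff_eq Nat.prime_two Fact.out).1
    (Nat.prime_two.dvd_of_dvd_pow h2)).symm

theorem coprime_of_forall_prime_dvd {a b : ℕ} {π : ℕ → Prop}
    (ha : ∀ q : ℕ, q.Prime → q ∣ a → π q) (hb : ∀ q : ℕ, q.Prime → q ∣ b → ¬ π q) :
    a.Coprime b :=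
  Nat.coprime_of_dvd fun q hq h h' => hb q hq h' (ha q hq h)

theorem factorization_natCard_of_mulEquiv_prod {G H K : Type*} [Group G] [Group H] [Group K]
    [Finite H] [Finite K] (e : G ≃* H × K) {q : ℕ} (hq : ¬ q ∣ Nat.card K) :
    (Nat.card H).factorization q = (Nat.card G).factorization q := by
  rw [Nat.card_congr e.toEquiv, Nat.card_prod,
    Nat.factorization_mul Nat.card_pos.ne' Nat.card_pos.ne', Finsupp.add_apply,
    Nat.factorization_eq_zero_of_not_dvd hq, add_zero]

/-- A finite nilpotent group is the product of its 2-part, an odd cyclic group and an odd group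
none of whose Sylow subgroups is cyclic. -/
theorem Group.IsNilpotent.exists_mulEquiv_prod_prod {G : Type*} [Group G] [Finite G]
    (hG : Group.IsNilpotent G) (P : Sylow 2 G) :
    ∃ (G₁ : Subgroup G) (n : ℕ), (Nat.card G₁).Coprime n ∧ (Nat.card G₁).Coprime 2 ∧
      n.Coprime 2 ∧ (Nontrivial G₁ → IsNilpotentWithoutCyclicOrQuaternionSylow G₁) ∧
      Nonempty (G ≃* G₁ × Multiplicative (ZMod n) × P) := by
  obtain ⟨H, K, hH, hK, ⟨e⟩⟩ := hG.exists_mulEquiv_prod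
    fun q => q ≠ 2 ∧ ∀ Q : Sylow q G, ¬ IsCyclic Q
  have hKn : Group.IsNilpotent K := inferInstance
  obtain ⟨T, C, hT, hC, ⟨e'⟩⟩ := hKn.exists_mulEquiv_prod fun q => q = 2
  have hCK : Nat.card C ∣ Nat.card K := Subgroup.card_subgroup_dvd_card C
  have hH2 : ¬ 2 ∣ Nat.card H := fun h => (hH 2 Nat.prime_two h).1 rfl
  have hC2 : ¬ 2 ∣ Nat.card C := fun h => hC 2 Nat.prime_two h rfl
  have hco2 : ∀ {n : ℕ}, ¬ 2 ∣ n → n.Coprime 2 := fun h =>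
    ((Nat.Prime.coprime_iff_not_dvd Nat.prime_two).2 h).symm
  have hCcyc : IsCyclic C := by
    -- Each Sylow subgroup of C embeds in a cyclic Sylow subgroup of G; a nilpotent group with all
    -- Sylow subgroups cyclic is cyclic.
    have : IsZGroup C := ⟨fun q hq S => by
      have : Fact q.Prime := ⟨hq⟩
      by_cases hqC : q ∣ Nat.card C
      · have h1 := hK q hq (hqC.trans hCK)
        have h2 : q ≠ 2 := hC q hq hqC
        push Not at h1
        obtain ⟨Q, hQ⟩ := h1 h2
        let f : C →* G := K.subtype.comp C.subtype
        have hf : Function.Injective f := K.subtype_injective.comp C.subtype_injective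
        have hle : ((S : Subgroup C).map f) ≤ Q := by
          obtain ⟨Q', hQ'⟩ := (S.isPGroup'.map f).exists_le_sylow
          have := Sylow.unique_of_normal Q inferInstance
          rwa [Subsingleton.elim Q' Q] at hQ'
        have := isCyclic_of_injective (Subgroup.inclusion hle) (Subgroup.inclusion_injective hle)
        exact isCyclic_of_injective ((S : Subgroup C).equivMapOfInjective f hf).toMonoidHom
          (MulEquiv.injective _)
      · have hS : Nat.card S = 1 := by
          rw [S.card_eq_multiplicity, Nat.factorization_eq_zero_of_not_dvd hqC, pow_zero]
        have := (Nat.card_eq_one_iff_unique.1 hS).1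
        exact isCyclic_of_subsingleton⟩
    infer_instance
  have hTP : Nonempty (T ≃* P) := by
    let f : T →* G := K.subtype.comp T.subtype
    have hf : Function.Injective f := K.subtype_injective.comp T.subtype_injective
    have hfac : (Nat.card T).factorization 2 = (Nat.card G).factorization 2 := by
      rw [factorization_natCard_of_mulEquiv_prod e' hC2,
        factorization_natCard_of_mulEquiv_prod (e.trans MulEquiv.prodComm) hH2]
    let S : Sylow 2 T := default
    have hS : (S : Subgroup T) = ⊤ := by
      refine Subgroup.eq_top_of_card_eq _ ?_
      have hcard := Nat.eq_prime_pow_of_unique_prime_dvd (Nat.card_pos (α := T)).ne' (hT _)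
      rw [show Nat.card (S : Subgroup T) = _ from S.card_eq_multiplicity, hcard,
        Nat.prime_two.factorization_pow, Finsupp.single_eq_same]
    obtain ⟨g⟩ := Sylow.nonempty_mulEquiv_of_injective hf hfac S P
    exact ⟨(Subgroup.topEquiv.symm.trans (MulEquiv.subgroupCongr hS.symm)).trans g⟩
  obtain ⟨g⟩ := hTP
  refine ⟨H, Nat.card C, ?_, hco2 hH2, hco2 hC2, fun hnt => ⟨inferInstance, hnt, inferInstance, ?_⟩,
    ⟨e.trans ((MulEquiv.refl H).prodCongr ((e'.trans MulEquiv.prodComm).trans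
      ((zmodCyclicMulEquiv hCcyc).symm.prodCongr g)))⟩⟩
  · exact coprime_of_forall_prime_dvd hH fun q hq h => hK q hq (h.trans hCK)
  · intro q hq hd S
    have : Fact q.Prime := ⟨hq⟩
    obtain ⟨hq2, hnc⟩ := hH q hq hd
    refine ⟨fun hS => ?_, S.isPGroup'.not_isGenQuaternion hq2⟩
    obtain ⟨g⟩ := Sylow.nonempty_mulEquiv_of_injective H.subtype_injective
      (factorization_natCard_of_mulEquiv_prod e fun h => hK q hq h ⟨hq2, hnc⟩) S default
    exact hnc _ (isCyclic_of_surjective g g.surjective)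

theorem mainTheorem5 {G : Type*} [Group G] [Finite G] (hG : Group.IsNilpotent G)
    (k : ℕ) (hk : 3 ≤ k) (P : Sylow 2 G) (hP : Nonempty (P ≃* GenQuaternion k)) :
    -- `G` is of one of the four forms
    (Nonempty (G ≃* GenQuaternion k) ∨
      (∃ n : ℕ, n.Coprime 2 ∧
        Nonempty (G ≃* Multiplicative (ZMod n) × GenQuaternion k)) ∨
      (∃ G₁ : Subgroup G, IsNilpotentWithoutCyclicOrQuaternionSylow G₁ ∧
        (Nat.card G₁).Coprime 2 ∧ Nonempty (G ≃* G₁ × GenQuaternion k)) ∨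
      (∃ (G₁ : Subgroup G) (n : ℕ), IsNilpotentWithoutCyclicOrQuaternionSylow G₁ ∧
        (Nat.card G₁).Coprime n ∧ (Nat.card G₁).Coprime 2 ∧ n.Coprime 2 ∧
        Nonempty (G ≃* G₁ × Multiplicative (ZMod n) × GenQuaternion k))) ∧
    -- `G = Q_{2^k}`
    (Nonempty (G ≃* GenQuaternion k) →
      dominationNumber (properEnhancedPowerGraph G) = ((2 ^ (k - 2) + 1 : ℕ) : ℕ∞)) ∧
    -- `G = Z_n × Q_{2^k}`
    (∀ n : ℕ, n.Coprime 2 → Nonempty (G ≃* Multiplicative (ZMod n) × GenQuaternion k) →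
      dominationNumber (properEnhancedPowerGraph G) = ((2 ^ (k - 2) + 1 : ℕ) : ℕ∞)) ∧
    -- `G = G₁ × Q_{2^k}`
    (∀ (G₁ : Type*) [Group G₁], IsNilpotentWithoutCyclicOrQuaternionSylow G₁ →
      (Nat.card G₁).Coprime 2 → Nonempty (G ≃* G₁ × GenQuaternion k) →
      dominationNumber (properEnhancedPowerGraph G) =
        ((min (minNumPrimeOrderSubgroups G₁) (2 ^ (k - 2) + 1) : ℕ) : ℕ∞)) ∧
    -- `G = G₁ × Z_n × Q_{2^k}`
    (∀ (G₁ : Type*) [Group G₁] (n : ℕ), IsNilpotentWithoutCyclicOrQuaternionSylow G₁ →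
      (Nat.card G₁).Coprime n → (Nat.card G₁).Coprime 2 → n.Coprime 2 →
      Nonempty (G ≃* G₁ × Multiplicative (ZMod n) × GenQuaternion k) →
      dominationNumber (properEnhancedPowerGraph G) =
        ((min (minNumPrimeOrderSubgroups G₁) (2 ^ (k - 2) + 1) : ℕ) : ℕ∞)) := by
  obtain ⟨eP⟩ := hP
  have hZ : ∀ n : ℕ, n.Coprime 2 → Finite (Multiplicative (ZMod n)) ∧
      Nat.card (Multiplicative (ZMod n)) = n := by
    intro n hn
    -- Coprimality to 2 excludes n = 0, where `ZMod 0` would be infinite.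
    have : NeZero n := ⟨by rintro rfl; simp at hn⟩
    exact ⟨inferInstance, by simp⟩
  refine ⟨?_, ?_, ?_, ?_, ?_⟩
  · obtain ⟨G₁, n, hn, h2, hn2, hG₁, ⟨e⟩⟩ := hG.exists_mulEquiv_prod_prod P
    -- Since n = 1 is allowed, the two forms with a factor Z_n already cover every case.
    rcases subsingleton_or_nontrivial G₁ with hs | hnt
    · have : Unique G₁ := uniqueOfSubsingleton 1
      exact .inr (.inl ⟨n, hn2,
        ⟨(e.trans MulEquiv.uniqueProd).trans ((MulEquiv.refl _).prodCongr eP)⟩⟩)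
    · exact .inr (.inr (.inr ⟨G₁, n, hG₁ hnt, hn, h2, hn2,
        ⟨e.trans ((MulEquiv.refl _).prodCongr ((MulEquiv.refl _).prodCongr eP))⟩⟩))
  · rintro ⟨e⟩
    exact dominationNumber_of_mulEquiv_isCyclic_prod (B := Unit) hk (by simp)
      (e.trans MulEquiv.uniqueProd.symm)
  · rintro n hn ⟨e⟩
    obtain ⟨hfin, hcard⟩ := hZ n hn
    exact dominationNumber_of_mulEquiv_isCyclic_prod hk (by rwa [hcard]) e
  · rintro G₁ _ hG₁ h2 ⟨e⟩
    exact dominationNumber_of_mulEquiv_prod (B := Unit) hk hG₁ (by simp) h2 (by simp)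
      (e.trans ((MulEquiv.refl _).prodCongr MulEquiv.uniqueProd.symm))
  · rintro G₁ _ n hG₁ hco h2 hn ⟨e⟩
    obtain ⟨hfin, hcard⟩ := hZ n hn
    exact dominationNumber_of_mulEquiv_prod hk hG₁ (by rwa [hcard]) h2 (by rwa [hcard]) e
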